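/- Let $(\mathcal V,\mathcal E)$ be a finite, nonempty, connected simple graph with a fixed planar embedding: vertices are distinct points of $\mathbb R^2$, each edge is an arc in $\mathbb R^2$ joining its two end vertices and containing no other vertex, and different edges meet at most in common end vertices. Let $\mathcal T$ be the set of tiles, i.e. of the closures of the connected components of the complement in $\mathbb R^2$ of the embedded graph (unbounded components included). Assume that: (i) every compact subset of $\mathbb R^2$ intersects only finitely many tiles; (ii) each bounded tile $T\in\mathcal T$ is the image of the closed unit disc under a homeomorphism $\mathbb R^2\to\mathbb R^2$, and its boundary $\partial T$ consists of the edges of a cycle of the graph with at least three edges; (iii) each edge is contained in the boundary of precisely two different tiles; (iv) each vertex has degree at least $3$. Let each edge $e\in\mathcal E$ be assigned a length $|e|\in(0,\infty)$. For a vertex $v$ let $m(v)=\sum_{e\ni v}|e|$ be the sum of the lengths of the edges incident to $v$. For a tile $T$ let $p(T)=\sum_{e\in\mathcal E:\,e\subseteq\partial T}|e|$ if $T$ is bounded, and $p(T)=\infty$ if $T$ is unbounded. For $e\in\mathcal E$ put $$c(e)=\frac1{|e|}-\sum_{v\in e}\frac1{m(v)}-\sum_{T\in\mathcal T:\,e\subseteq\partial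 T}\frac1{p(T)},$$ where the second term sums over the two end vertices of $e$ and $1/\infty=0$. Then $$\sum_{e\in\mathcal E}-c(e)\,|e|=1 .$$ -/

import Mathlib

open scoped ENNReal

/-- The Euclidean plane `ℝ²`. -/
abbrev Plane : Type := EuclideanSpace ℝ (Fin 2)

/-- A planar embedding of a finite simple graph `G`: distinct vertices are distinct points of the
plane, every edge `uv` is a (continuous, injective) arc from `u` to `v` that passes through no other
vertex, and two different arcs meet at most in common end points. -/
structure PlaneEmbedding {V : Type*} (G : SimpleGraph V) where
  /-- the point of the plane that represents a vertex -/
  point : V → Plane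
  /-- the closed arc, end points included, that represents an edge -/
  arc : G.edgeSet → Set Plane
  point_injective : Function.Injective point
  exists_path : ∀ (e : G.edgeSet) (u v : V), (e : Sym2 V) = s(u, v) →
    ∃ γ : Path (point u) (point v), Function.Injective γ ∧ Set.range γ = arc e
  mem_of_point_mem_arc : ∀ (e : G.edgeSet) (v : V), point v ∈ arc e → v ∈ (e : Sym2 V)
  arc_inter_subset : ∀ e e' : G.edgeSet, e ≠ e' →
    arc e ∩ arc e' ⊆ point '' {v | v ∈ (e : Sym2 V) ∧ v ∈ (e' : Sym2 V)}

namespace PlaneEmbedding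

variable {V : Type*} {G : SimpleGraph V}

/-- The embedded graph, as a subset of the plane. -/
def support (Γ : PlaneEmbedding G) : Set Plane :=
  Set.range Γ.point ∪ ⋃ e : G.edgeSet, Γ.arc e

/-- The tiles: the closures of the connected components of the complement of the graph
(unbounded ones included). -/
def tiles (Γ : PlaneEmbedding G) : Set (Set Plane) :=
  {T | ∃ x ∈ Γ.supportᶜ, T = closure (connectedComponentIn Γ.supportᶜ x)}

/-- `𝓔_T`, the set of edges contained in the boundary of `T`. -/
def tileEdges (Γ : PlaneEmbedding G) (T : Set Plane) : Set G.edgeSet :=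
  {e | Γ.arc e ⊆ frontier T}

/-- The set of tiles whose boundary contains the edge `e`. -/
def edgeTiles (Γ : PlaneEmbedding G) (e : G.edgeSet) : Set (Set Plane) :=
  {T | T ∈ Γ.tiles ∧ Γ.arc e ⊆ frontier T}

/-- The boundary of `T` is the union of the edges of a cycle of `G` with at least three edges. -/
def FrontierIsCycle (Γ : PlaneEmbedding G) (T : Set Plane) : Prop :=
  ∃ (v : V) (p : G.Walk v v), p.IsCycle ∧ 3 ≤ p.length ∧
    frontier T = ⋃ (e : G.edgeSet) (_ : (e : Sym2 V) ∈ p.edges), Γ.arc e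

end PlaneEmbedding

/-- A closed topological disc: the image of the closed unit disc under a homeomorphism of the
plane. -/
def IsClosedTopologicalDisc (T : Set Plane) : Prop :=
  ∃ φ : Plane ≃ₜ Plane, φ '' Metric.closedBall (0 : Plane) 1 = T

/-- A finite tessellating plane graph: a tessellating plane graph, without any condition on the
shape of the unbounded tiles. -/
structure IsFiniteTessellating {V : Type*} {G : SimpleGraph V} (Γ : PlaneEmbedding G) : Prop where
  finite_vertices : Finite V
  connected : G.Connected
  locally_finite : ∀ K : Set Plane, IsCompact K → {T | T ∈ Γ.tiles ∧ (T ∩ K).Nonempty}.Finite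
  bounded_tile : ∀ T ∈ Γ.tiles, Bornology.IsBounded T →
    IsClosedTopologicalDisc T ∧ Γ.FrontierIsCycle T
  edge_tiles : ∀ e : G.edgeSet, (Γ.edgeTiles e).ncard = 2
  three_le_degree : ∀ v : V, 3 ≤ (G.incidenceSet v).ncard

noncomputable section

namespace PlaneEmbedding

variable {V : Type*} {G : SimpleGraph V}

/-- The weight `m(v)`, the total length of the edges at `v`, for edge lengths `ℓ`. -/
def weight (ℓ : G.edgeSet → ℝ) (v : V) : ℝ :=
  ∑ᶠ (e : G.edgeSet) (_ : v ∈ (e : Sym2 V)), ℓ e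

open Classical in
/-- The perimeter `p(T)`: the total length of the boundary edges of a bounded tile, and `∞` for an
unbounded one. -/
def perimeter (Γ : PlaneEmbedding G) (ℓ : G.edgeSet → ℝ) (T : Set Plane) : ℝ≥0∞ :=
  if Bornology.IsBounded T then ENNReal.ofReal (∑ᶠ e ∈ Γ.tileEdges T, ℓ e) else ∞

/-- The characteristic value `c(e) = 1/|e| - ∑_{v ∈ e} 1/m(v) - ∑_{T : e ⊆ ∂T} 1/p(T)`,
where `1/∞ = 0`. -/
def charValue (Γ : PlaneEmbedding G) (ℓ : G.edgeSet → ℝ) (e : G.edgeSet) : ℝ :=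
  1 / ℓ e - (∑ᶠ (v : V) (_ : v ∈ (e : Sym2 V)), 1 / weight ℓ v)
    - ∑ᶠ T ∈ Γ.edgeTiles e, ((Γ.perimeter ℓ T)⁻¹).toReal

end PlaneEmbedding

end

/-!
Since `∑ₑ |e| / m(v)` over the edges at `v` is `1`, and likewise `∑ₑ |e| / p(T)` over the edges of a
bounded tile, exchanging the order of summation turns the left-hand side into `V + F - E`, where `F`
is the number of bounded tiles (unbounded ones contribute `1/∞ = 0`).  What is left is Euler's
formula `V + F = E + 1`, `PlaneEmbedding.card_add_ncard_boundedTiles`.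

Euler's formula is a dimension count for cochains with complex coefficients.  For a point `p` off
the graph let `a_p` be the cochain whose value on an edge is the increment of a continuous logarithm
of `z - p` along the edge.  Consider the linear map `(h, c) ↦ δh + ∑ c_T a_{p_T}`, from functions
on the vertices and on the bounded tiles to functions on the edges, where `p_T` is a point inside
the tile `T`.

* Its kernel consists of the constants.  Indeed, the circulation along the boundary cycle of `T`
  kills coboundaries; it kills `a_q` for `q ∉ T`, because a closed disc does not separate the plane,
  so that `z - q` has a logarithm on `T`; and it does not kill `a_{p_T}`: if it did, then `z - p_T`
  would have a logarithm on `∂T`, and thus extend from the complement of `T` to a nonvanishing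
  function on the plane, which has a logarithm, although `z - p_T` has none on a large circle.
* It is surjective.  Let `Z` be a functional that kills its range.  Then `Z` kills `a_p` for all `p`
  off the graph, since `a_p` is a coboundary for `p` in the unbounded tile.  An edge `e` lies on
  two tiles `T` and `T'`, one of them bounded, say `T`.  Subtract from `Z` the multiple of the
  circulation around `T` that removes `e`.  As `p_T` and `p_{T'}` are joined across `e`, the cochain
  `a_{p_T} - a_{p_{T'}}` is a coboundary off `e` and is killed by the difference.  So the multiple
  is zero, and `Z` vanishes on `e`.
-/

open Set Filter Topology Bornology

/-! ### Continuous logarithms -/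

/-- Two complex functions are equivalent on `A` if they differ there by a factor with a continuous
logarithm.  In particular `LogEquivOn A f 1` says that `f` has a continuous logarithm on `A`. -/
def LogEquivOn {X : Type*} [TopologicalSpace X] (A : Set X) (f f' : X → ℂ) : Prop :=
  ∃ g : X → ℂ, ContinuousOn g A ∧ ∀ z ∈ A, f z = f' z * Complex.exp (g z)

namespace LogEquivOn

variable {X : Type*} [TopologicalSpace X] {A : Set X} {f f₁ f₂ : X → ℂ}

theorem refl (A : Set X) (f : X → ℂ) : LogEquivOn A f f :=
  ⟨0, continuousOn_const, by simp⟩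

theorem symm (h : LogEquivOn A f f₁) : LogEquivOn A f₁ f := by
  obtain ⟨g, hg, h⟩ := h
  refine ⟨-g, hg.neg, fun z hz ↦ ?_⟩
  rw [h z hz, mul_assoc, ← Complex.exp_add]
  simp

theorem trans (h : LogEquivOn A f f₁) (h' : LogEquivOn A f₁ f₂) : LogEquivOn A f f₂ := by
  obtain ⟨g, hg, h⟩ := h
  obtain ⟨g', hg', h'⟩ := h'
  refine ⟨g' + g, hg'.add hg, fun z hz ↦ ?_⟩
  rw [h z hz, h' z hz, mul_assoc, ← Complex.exp_add, Pi.add_apply]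

end LogEquivOn

/-- Two continuous logarithms of the same function on a connected set have the same increments:
their difference is an integer multiple of `2πi`, and hence constant. -/
theorem sub_eq_sub_of_exp_eq {X : Type*} [TopologicalSpace X] {A : Set X} (hA : IsPreconnected A)
    {g g' : X → ℂ} (hg : ContinuousOn g A) (hg' : ContinuousOn g' A)
    (h : ∀ z ∈ A, Complex.exp (g z) = Complex.exp (g' z)) {x y : X} (hx : x ∈ A) (hy : y ∈ A) :
    g y - g x = g' y - g' x := by
  have hint : ∀ z ∈ A, ∃ n : ℤ, g z = g' z + n * (2 * Real.pi * Complex.I) := fun z hz ↦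
    Complex.exp_eq_exp_iff_exists_int.1 (h z hz)
  have hdisc : IsDiscrete (range ((↑) : ℤ → ℝ)) :=
    Int.isClosedEmbedding_coe_real.isInducing.isDiscrete_range
  have hc : ContinuousOn (fun z ↦ ((g z - g' z) / (2 * Real.pi * Complex.I)).re) A :=
    Complex.continuous_re.comp_continuousOn ((hg.sub hg').div_const _)
  have hval : ∀ z (n : ℤ), g z = g' z + n * (2 * Real.pi * Complex.I) →
      ((g z - g' z) / (2 * Real.pi * Complex.I)).re = n := by
    intro z n hn
    rw [hn, add_sub_cancel_left, mul_div_cancel_right₀ _ Complex.two_pi_I_ne_zero]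
    simp
  obtain ⟨n, hn⟩ := hint x hx
  obtain ⟨m, hm⟩ := hint y hy
  have key := hA.constant_of_mapsTo hdisc hc (fun z hz ↦ by
    obtain ⟨k, hk⟩ := hint z hz
    exact ⟨k, (hval z k hk).symm⟩) hx hy
  simp only [hval x n hn, hval y m hm, Int.cast_inj] at key
  rw [hn, hm, key]
  ring

open Classical in
/-- The increment from `x` to `y` of a continuous logarithm of `f` on `A` (zero if there is none).
For connected `A` it does not depend on the logarithm, see `logIncrement_eq`. -/
noncomputable def logIncrement {X : Type*} [TopologicalSpace X] (A : Set X) (f : X → ℂ)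
    (x y : X) : ℂ :=
  if h : LogEquivOn A f 1 then h.choose y - h.choose x else 0

theorem logIncrement_eq {X : Type*} [TopologicalSpace X] {A : Set X} (hA : IsPreconnected A)
    {f g : X → ℂ} (hg : ContinuousOn g A) (h : ∀ z ∈ A, f z = Complex.exp (g z)) {x y : X}
    (hx : x ∈ A) (hy : y ∈ A) : logIncrement A f x y = g y - g x := by
  have hf : LogEquivOn A f 1 := ⟨g, hg, fun z hz ↦ by simp [h z hz]⟩
  rw [logIncrement, dif_pos hf]
  refine sub_eq_sub_of_exp_eq hA hf.choose_spec.1 hg (fun z hz ↦ ?_) hx hy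
  rw [← h z hz, hf.choose_spec.2 z hz, Pi.one_apply, one_mul]

theorem logIncrement_sub {X : Type*} [TopologicalSpace X] {A : Set X} (hA : IsPreconnected A)
    {f f' g : X → ℂ} (hf : LogEquivOn A f' 1) (hg : ContinuousOn g A)
    (h : ∀ z ∈ A, f z = f' z * Complex.exp (g z)) {x y : X}
    (hx : x ∈ A) (hy : y ∈ A) :
    logIncrement A f x y - logIncrement A f' x y = g y - g x := by
  obtain ⟨k, hk, hkf⟩ := hf
  rw [logIncrement_eq (f := f') hA hk (fun z hz ↦ by simpa using hkf z hz) hx hy,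
    logIncrement_eq (f := f) hA (hk.add hg) (fun z hz ↦ ?_) hx hy, Pi.add_apply, Pi.add_apply]
  · ring
  · rw [h z hz, hkf z hz, Pi.one_apply, one_mul, ← Complex.exp_add, Pi.add_apply]

theorem exp_logIncrement {X : Type*} [TopologicalSpace X] {A : Set X} {f : X → ℂ}
    (h : LogEquivOn A f 1) {x y : X} (hx : x ∈ A) (hy : y ∈ A) :
    f x * Complex.exp (logIncrement A f x y) = f y := by
  have h1 := h.choose_spec.2
  rw [logIncrement, dif_pos h, h1 x hx, h1 y hy]
  simp [← Complex.exp_add]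

theorem logIncrement_symm {X : Type*} [TopologicalSpace X] (A : Set X) (f : X → ℂ) (x y : X) :
    logIncrement A f y x = -logIncrement A f x y := by
  unfold logIncrement
  split_ifs <;> simp

/-- A continuous nonvanishing function has a continuous logarithm on an arc. -/
theorem logEquivOn_range_path {X : Type*} [TopologicalSpace X] [NormalSpace X] [T2Space X]
    {x y : X} (γ : Path x y) (hγ : Function.Injective γ) {f : X → ℂ} (hf : Continuous f)
    (h0 : ∀ z ∈ range γ, f z ≠ 0) : LogEquivOn (range γ) f 1 := by
  have hne : ∀ t, f (γ t) ≠ 0 := fun t ↦ h0 _ ⟨t, rfl⟩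
  have : ContractibleSpace unitInterval :=
    (convex_Icc (0 : ℝ) 1).contractibleSpace ⟨0, by simp⟩
  have : LocallyPathConnectedSpace unitInterval :=
    (convex_Icc (0 : ℝ) 1).locallyPathConnectedSpace
  obtain ⟨L, ⟨-, hL⟩, -⟩ := Complex.isCoveringMapOn_exp.existsUnique_continuousMap_lifts
    (⟨fun t ↦ f (γ t), hf.comp γ.continuous⟩ : C(unitInterval, ℂ)) (a₀ := 0)
    (Complex.exp_log (hne 0)) (fun t ↦ by simpa using hne t)
  have hγe : IsClosedEmbedding γ := γ.continuous.isClosedEmbedding hγ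
  obtain ⟨g, hg⟩ := L.exists_extension hγe
  refine ⟨g, g.continuous.continuousOn, ?_⟩
  rintro _ ⟨t, rfl⟩
  have h1 : g (γ t) = L t := congr($hg t)
  have h2 : Complex.exp (L t) = f (γ t) := congr($hL t)
  simp [h1, h2]

/-! ### The functions `z - p` on the plane -/

/-- The identification of the Euclidean plane with `ℂ`. -/
noncomputable def planeToComplex : Plane ≃ₗᵢ[ℝ] ℂ := Complex.orthonormalBasisOneI.repr.symm

/-- The function `z ↦ z - p` on the plane, with values in `ℂ`. -/
noncomputable def planeSub (p z : Plane) : ℂ := planeToComplex (z - p)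

theorem continuous_planeSub (p : Plane) : Continuous (planeSub p) :=
  planeToComplex.continuous.comp (continuous_id.sub continuous_const)

theorem norm_planeSub (p z : Plane) : ‖planeSub p z‖ = dist z p := by
  rw [planeSub, LinearIsometryEquiv.norm_map, dist_eq_norm]

theorem planeSub_ne_zero {p z : Plane} (h : z ≠ p) : planeSub p z ≠ 0 := by
  rw [← norm_pos_iff, norm_planeSub]
  exact dist_pos.2 h

/-- Being close to `f'` relative to the size of `f'` gives a logarithm of the quotient. -/
theorem logEquivOn_of_norm_sub_lt {X : Type*} [TopologicalSpace X] {A : Set X} {f f' : X → ℂ}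
    (hf : ContinuousOn f A) (hf' : ContinuousOn f' A) (h : ∀ z ∈ A, ‖f z - f' z‖ < ‖f' z‖) :
    LogEquivOn A f f' := by
  have h0 : ∀ z ∈ A, f' z ≠ 0 := fun z hz ↦ norm_pos_iff.1 ((norm_nonneg _).trans_lt (h z hz))
  have hs : ∀ z ∈ A, f z / f' z ∈ Complex.slitPlane := fun z hz ↦ by
    have h1 : ‖f z / f' z - 1‖ < 1 := by
      rw [div_sub_one (h0 z hz), norm_div, div_lt_one (norm_pos_iff.2 (h0 z hz))]
      exact h z hz
    simpa using Complex.mem_slitPlane_of_norm_lt_one h1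
  refine ⟨fun z ↦ Complex.log (f z / f' z), (hf.div hf' h0).clog hs, fun z hz ↦ ?_⟩
  rw [Complex.exp_log (Complex.slitPlane_ne_zero (hs z hz)), mul_div_cancel₀ _ (h0 z hz)]

theorem logEquivOn_planeSub_of_dist_lt {A : Set Plane} {p q : Plane}
    (h : ∀ z ∈ A, dist p q < dist z q) : LogEquivOn A (planeSub p) (planeSub q) := by
  refine logEquivOn_of_norm_sub_lt (continuous_planeSub p).continuousOn
    (continuous_planeSub q).continuousOn fun z hz ↦ ?_
  have : planeSub p z - planeSub q z = planeToComplex (q - p) := by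
    simp only [planeSub, ← map_sub]
    congr 1
    abel
  rw [this, norm_planeSub, LinearIsometryEquiv.norm_map, ← dist_eq_norm, dist_comm]
  exact h z hz

/-- If `p` and `q` are not separated by the closed set `A`, then `z - p` and `z - q` are
equivalent on `A`: the equivalence classes of `p ∉ A` are open. -/
theorem logEquivOn_planeSub_of_isPreconnected {A S : Set Plane} (hA : IsClosed A)
    (hS : IsPreconnected S) (hSA : Disjoint S A) {p q : Plane} (hp : p ∈ S) (hq : q ∈ S) :
    LogEquivOn A (planeSub p) (planeSub q) := by
  have hnear : ∀ x ∉ A, ∀ᶠ y in 𝓝 x, y ∉ A ∧ LogEquivOn A (planeSub y) (planeSub x) := by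
    intro x hx
    obtain ⟨ε, hε, hball⟩ := Metric.isOpen_iff.1 hA.isOpen_compl x hx
    filter_upwards [Metric.ball_mem_nhds x hε] with y hy
    refine ⟨hball hy, logEquivOn_planeSub_of_dist_lt fun z hz ↦ ?_⟩
    refine lt_of_lt_of_le hy (not_lt.1 fun hlt ↦ hball hlt hz)
  let U : Set Plane := {x | x ∉ A ∧ LogEquivOn A (planeSub p) (planeSub x)}
  let W : Set Plane := {x | x ∉ A ∧ ¬ LogEquivOn A (planeSub p) (planeSub x)}
  have hU : IsOpen U := isOpen_iff_mem_nhds.2 fun x hx ↦ by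
    filter_upwards [hnear x hx.1] with y hy using ⟨hy.1, hx.2.trans hy.2.symm⟩
  have hW : IsOpen W := isOpen_iff_mem_nhds.2 fun x hx ↦ by
    filter_upwards [hnear x hx.1] with y hy using ⟨hy.1, fun h ↦ hx.2 (h.trans hy.2)⟩
  have hsub : S ⊆ U := hS.subset_left_of_subset_union hU hW
    (disjoint_left.2 fun x hx hx' ↦ hx'.2 hx.2)
    (fun x hx ↦ by
      have hxA : x ∉ A := disjoint_left.1 hSA hx
      by_cases h : LogEquivOn A (planeSub p) (planeSub x)
      · exact Or.inl ⟨hxA, h⟩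
      · exact Or.inr ⟨hxA, h⟩)
    ⟨p, hp, disjoint_left.1 hSA hp, .refl _ _⟩
  exact (hsub hq).2

/-- If `p` can be moved to infinity off the compact set `A`, then `z - p` has a logarithm on `A`. -/
theorem logEquivOn_planeSub_one {A S : Set Plane} (hA : IsCompact A)
    (hS : IsPreconnected S) (hSA : Disjoint S A) (hSb : ¬ IsBounded S) {p : Plane} (hp : p ∈ S) :
    LogEquivOn A (planeSub p) 1 := by
  obtain ⟨R, hR⟩ := hA.isBounded.subset_closedBall 0
  obtain ⟨q, hq, hqR⟩ : ∃ q ∈ S, R < ‖q‖ := by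
    by_contra! h
    exact hSb ((Metric.isBounded_closedBall (x := (0 : Plane)) (r := R)).subset fun q hq ↦ by
      simpa using h q hq)
  refine (logEquivOn_planeSub_of_isPreconnected hA.isClosed hS hSA hp hq).trans ?_
  have hc : LogEquivOn A (planeSub q) (fun _ ↦ planeToComplex (-q)) := by
    refine logEquivOn_of_norm_sub_lt (continuous_planeSub q).continuousOn continuousOn_const
      fun z hz ↦ ?_
    have : planeSub q z - planeToComplex (-q) = planeToComplex z := by
      simp [planeSub]
    rw [this, LinearIsometryEquiv.norm_map, LinearIsometryEquiv.norm_map, norm_neg]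
    exact lt_of_le_of_lt (by simpa using hR hz) hqR
  refine hc.trans ⟨fun _ ↦ Complex.log (planeToComplex (-q)), continuousOn_const, fun z hz ↦ ?_⟩
  have hq0 : q ≠ 0 := by
    rintro rfl
    have h1 : ‖z‖ ≤ R := by simpa using hR hz
    rw [norm_zero] at hqR
    linarith [norm_nonneg z]
  rw [Complex.exp_log (by simpa using hq0)]
  simp

/-- The complement of a closed ball is connected: it is a radial image of the punctured plane. -/
theorem isPreconnected_compl_closedBall {R : ℝ} (hR : 0 ≤ R) :
    IsPreconnected (Metric.closedBall (0 : Plane) R)ᶜ := by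
  have h0 : IsPreconnected ({0}ᶜ : Set Plane) :=
    (isConnected_compl_singleton_of_one_lt_rank
      (by simp [← Module.finrank_eq_rank]) _).isPreconnected
  have hc : ContinuousOn (fun x : Plane ↦ (1 + R / ‖x‖) • x) {0}ᶜ :=
    (continuousOn_const.add (continuousOn_const.div continuous_norm.continuousOn
      fun x hx ↦ norm_ne_zero_iff.2 hx)).smul continuousOn_id
  convert! h0.image _ hc using 1
  ext y
  simp only [mem_compl_iff, Metric.mem_closedBall, dist_zero_right, not_le, mem_image,
    mem_singleton_iff]
  constructor
  · intro hy
    have hy0 : 0 < ‖y‖ := hR.trans_lt hy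
    have ht : 0 < 1 - R / ‖y‖ := by rw [sub_pos, div_lt_one hy0]; exact hy
    refine ⟨(1 - R / ‖y‖) • y, smul_ne_zero ht.ne' (norm_pos_iff.1 hy0), ?_⟩
    rw [norm_smul, Real.norm_of_nonneg ht.le, smul_smul]
    have : (1 + R / ((1 - R / ‖y‖) * ‖y‖)) * (1 - R / ‖y‖) = 1 := by
      have : ‖y‖ - R ≠ 0 := by linarith
      field_simp
      ring
    rw [this, one_smul]
  · rintro ⟨x, hx, rfl⟩
    have hx0 : 0 < ‖x‖ := norm_pos_iff.2 hx
    rw [norm_smul, Real.norm_of_nonneg (by positivity), add_mul, div_mul_cancel₀ _ hx0.ne']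
    linarith

/-- The function `z - p` has no continuous logarithm on a large circle. -/
theorem not_logEquivOn_planeSub_sphere {p : Plane} {R : ℝ} (hR : 0 < R) :
    ¬ LogEquivOn (Metric.sphere p R) (planeSub p) 1 := by
  rintro ⟨g, hg, h⟩
  -- along the circle, `log R + i t` is a logarithm of `z - p` that is not periodic
  let c : ℝ → Plane := fun t ↦ p + planeToComplex.symm (R * Complex.exp (t * Complex.I))
  have hcc : Continuous c := by fun_prop
  have hcs : ∀ t, c t ∈ Metric.sphere p R := fun t ↦ by
    simp [c, Complex.norm_exp_ofReal_mul_I, abs_of_pos hR]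
  have key := sub_eq_sub_of_exp_eq (isPreconnected_univ (α := ℝ)) (g := g ∘ c)
    (g' := fun t ↦ Complex.log R + t * Complex.I)
    (continuousOn_univ.2 (hg.comp_continuous hcc hcs)) (by fun_prop)
    (fun t _ ↦ by
      have h1 := h _ (hcs t)
      rw [Pi.one_apply, one_mul] at h1
      rw [Function.comp_apply, ← h1, Complex.exp_add,
        Complex.exp_log (by exact_mod_cast hR.ne')]
      simp [c, planeSub]) (mem_univ 0) (mem_univ (2 * Real.pi))
  have hper : c (2 * Real.pi) = c 0 := by
    simp [c]
  simp [hper, Real.pi_ne_zero] at key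

/-- For a point `p` of a compact set `T`, the function `z - p` has no continuous
logarithm on the frontier of `T`.  Otherwise it would extend to a nonvanishing function on `T` and,
by itself outside `T`, on the whole plane, hence would have a logarithm on a large circle. -/
theorem not_logEquivOn_planeSub_frontier {T : Set Plane} (hT : IsCompact T) {p : Plane}
    (hp : p ∈ T) : ¬ LogEquivOn (frontier T) (planeSub p) 1 := by
  classical
  rintro ⟨g, hg, h⟩
  -- Tietze: a continuous extension `k` of the logarithm to the plane
  obtain ⟨k, hk⟩ := ContinuousMap.exists_restrict_eq (isClosed_frontier (s := T))
    ⟨(frontier T).domRestrict g, continuousOn_iff_continuous_domRestrict.1 hg⟩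
  have hkg : ∀ z ∈ frontier T, k z = g z := fun z hz ↦ congr($hk ⟨z, hz⟩)
  let F : Plane → ℂ := T.piecewise (fun z ↦ Complex.exp (k z)) (planeSub p)
  have hF : Continuous F := by
    refine continuous_piecewise (fun z hz ↦ ?_) ?_ (continuous_planeSub p).continuousOn
    · rw [hkg z hz, h z hz, Pi.one_apply, one_mul]
    · exact (Complex.continuous_exp.comp k.continuous).continuousOn
  have hF0 : ∀ z, F z ≠ 0 := fun z ↦ by
    by_cases hz : z ∈ T
    · simp [F, hz]
    · simpa [F, hz] using planeSub_ne_zero (ne_of_mem_of_not_mem hp hz).symm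
  obtain ⟨L, ⟨-, hL⟩, -⟩ := Complex.isCoveringMapOn_exp.existsUnique_continuousMap_lifts
    (⟨F, hF⟩ : C(Plane, ℂ)) (a₀ := 0) (Complex.exp_log (hF0 0)) (fun t ↦ by simpa using hF0 t)
  obtain ⟨R, hR⟩ := hT.isBounded.subset_closedBall p
  refine not_logEquivOn_planeSub_sphere (p := p) (R := |R| + 1) (by positivity)
    ⟨L, L.continuous.continuousOn, fun z hz ↦ ?_⟩
  have hzT : z ∉ T := fun hzT ↦ by
    have h1 : dist z p ≤ R := hR hzT
    have h2 : dist z p = |R| + 1 := hz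
    linarith [le_abs_self R]
  have h2 : Complex.exp (L z) = F z := congr($hL z)
  simp [h2, F, hzT]

/-! ### Cochains on a graph -/

namespace SimpleGraph

variable {V : Type*} {G : SimpleGraph V}

/-- The first end vertex of an edge, for an arbitrarily chosen orientation of each edge. -/
noncomputable def edgeTail (e : G.edgeSet) : V := (Quot.out (e : Sym2 V)).1

/-- The second end vertex of an edge, for the orientation that `edgeTail` uses. -/
noncomputable def edgeHead (e : G.edgeSet) : V := (Quot.out (e : Sym2 V)).2

theorem mk_edgeTail_edgeHead (e : G.edgeSet) : s(edgeTail e, edgeHead e) = (e : Sym2 V) :=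
  Quot.out_eq (e : Sym2 V)

theorem edgeTail_mem (e : G.edgeSet) : edgeTail e ∈ (e : Sym2 V) :=
  (mk_edgeTail_edgeHead e).subst (motive := fun s ↦ edgeTail e ∈ s) (Sym2.mem_mk_left _ _)

theorem edgeHead_mem (e : G.edgeSet) : edgeHead e ∈ (e : Sym2 V) :=
  (mk_edgeTail_edgeHead e).subst (motive := fun s ↦ edgeHead e ∈ s) (Sym2.mem_mk_right _ _)

/-- The coboundary of a function on the vertices: its increment along each oriented edge. -/
noncomputable def coboundary (G : SimpleGraph V) : (V → ℂ) →ₗ[ℂ] (G.edgeSet → ℂ) :=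
  LinearMap.funLeft ℂ ℂ edgeHead - LinearMap.funLeft ℂ ℂ edgeTail

@[simp]
theorem coboundary_apply (h : V → ℂ) (e : G.edgeSet) :
    G.coboundary h e = h (edgeHead e) - h (edgeTail e) := rfl

/-- The edge of a dart, as an element of the edge set. -/
def Dart.toEdgeSet (d : G.Dart) : G.edgeSet := ⟨d.edge, d.edge_mem⟩

open Classical in
/-- Evaluation of a cochain at a dart: its value at the edge, with a sign that compares the
direction of the dart with the chosen orientation. -/
noncomputable def dartEval (d : G.Dart) : (G.edgeSet → ℂ) →ₗ[ℂ] ℂ :=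
  (if d.fst = edgeTail d.toEdgeSet then 1 else -1 : ℂ) • LinearMap.proj d.toEdgeSet

open Classical in
theorem dartEval_apply (d : G.Dart) (a : G.edgeSet → ℂ) :
    dartEval d a = (if d.fst = edgeTail d.toEdgeSet then 1 else -1) * a d.toEdgeSet := rfl

theorem dartEval_eq {φ : V → V → ℂ} (hφ : ∀ x y, φ y x = -φ x y) {a : G.edgeSet → ℂ} {d : G.Dart}
    (ha : a d.toEdgeSet = φ (edgeTail d.toEdgeSet) (edgeHead d.toEdgeSet)) :
    dartEval d a = φ d.fst d.snd := by
  have h : s(edgeTail d.toEdgeSet, edgeHead d.toEdgeSet) = s(d.fst, d.snd) :=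
    mk_edgeTail_edgeHead _
  rw [dartEval_apply, ha]
  rcases Sym2.eq_iff.1 h with ⟨h1, h2⟩ | ⟨h1, h2⟩
  · rw [h1, h2]; simp
  · rw [h1, h2, if_neg d.adj.ne, hφ]; simp

theorem dartEval_coboundary (h : V → ℂ) (d : G.Dart) :
    dartEval d (G.coboundary h) = h d.snd - h d.fst :=
  dartEval_eq (φ := fun x y ↦ h y - h x) (fun x y ↦ by ring) rfl

/-- The signed sum of a cochain along a walk. -/
noncomputable def Walk.circulation {u v : V} (p : G.Walk u v) : (G.edgeSet → ℂ) →ₗ[ℂ] ℂ :=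
  (p.darts.map dartEval).sum

theorem Walk.circulation_apply {u v : V} (p : G.Walk u v) (a : G.edgeSet → ℂ) :
    p.circulation a = (p.darts.map fun d ↦ dartEval d a).sum := by
  have := map_list_sum (LinearMap.applyₗ (R := ℂ) a : ((G.edgeSet → ℂ) →ₗ[ℂ] ℂ) →ₗ[ℂ] ℂ)
    (p.darts.map dartEval)
  simpa [circulation, Function.comp_def] using this

theorem Walk.sum_darts_sub {u v : V} (p : G.Walk u v) (h : V → ℂ) :
    (p.darts.map fun d ↦ h d.snd - h d.fst).sum = h v - h u := by
  induction p with
  | nil => simp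
  | cons hadj p ih => simp [ih]

theorem Walk.circulation_coboundary {u : V} (p : G.Walk u u) (h : V → ℂ) :
    p.circulation (G.coboundary h) = 0 := by
  simp [circulation_apply, dartEval_coboundary, sum_darts_sub]

/-- A cochain that agrees along the closed walk `p` with the increments of `h` has circulation
zero. -/
theorem Walk.circulation_eq_zero {u : V} (p : G.Walk u u) {a : G.edgeSet → ℂ} (h : V → ℂ)
    (ha : ∀ d ∈ p.darts, a d.toEdgeSet = G.coboundary h d.toEdgeSet) : p.circulation a = 0 := by
  rw [← p.circulation_coboundary h, circulation_apply, circulation_apply]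
  congr 1
  refine List.map_congr_left fun d hd ↦ ?_
  rw [dartEval_apply, dartEval_apply, ha d hd]

open Classical in
theorem Walk.circulation_single_ne_zero {u v : V} {p : G.Walk u v} (hp : p.edges.Nodup)
    {e : G.edgeSet} (he : (e : Sym2 V) ∈ p.edges) : p.circulation (Pi.single e 1) ≠ 0 := by
  rw [circulation_apply]
  rw [Walk.edges] at hp he
  obtain ⟨d, hd, hde⟩ := List.mem_map.1 he
  rw [List.sum_map_eq_nsmul_single d, List.count_eq_one_of_mem hp.of_map hd, one_smul]
  · have : d.toEdgeSet = e := Subtype.ext hde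
    rw [dartEval_apply, this]
    split_ifs <;> simp
  · intro d' hne hd'
    have : d'.toEdgeSet ≠ e := fun h ↦ hne <|
      List.inj_on_of_nodup_map hp hd' hd (by rw [hde, ← h]; rfl)
    simp [dartEval_apply, this]

theorem Walk.IsPath.exists_potential {u v : V} {p : G.Walk u v} (hp : p.IsPath) (α : G.Dart → ℂ)
    (c : ℂ) : ∃ h : V → ℂ, h u = c ∧ ∀ d ∈ p.darts, h d.snd - h d.fst = α d := by
  classical
  induction p generalizing c with
  | nil => exact ⟨fun _ ↦ c, rfl, by simp⟩
  | @cons u v w hadj p ih =>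
    rw [cons_isPath_iff] at hp
    obtain ⟨h, hv, hd⟩ := ih hp.1 (c + α ⟨(u, v), hadj⟩)
    refine ⟨Function.update h u c, by simp, fun d hdm ↦ ?_⟩
    rw [darts_cons, List.mem_cons] at hdm
    rcases hdm with rfl | hdm
    · simp [hadj.ne', hv]
    · have h1 : d.fst ≠ u := fun h ↦ hp.2 (h ▸ p.dart_fst_mem_support_of_mem_darts hdm)
      have h2 : d.snd ≠ u := fun h ↦ hp.2 (h ▸ p.dart_snd_mem_support_of_mem_darts hdm)
      simp [h1, h2, hd d hdm]

/-- A function on the darts of a cycle with sum zero is the increment of a function on the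
vertices. -/
theorem Walk.IsCycle.exists_potential {u : V} {p : G.Walk u u} (hp : p.IsCycle) (α : G.Dart → ℂ)
    (hα : (p.darts.map α).sum = 0) (c : ℂ) :
    ∃ h : V → ℂ, h u = c ∧ ∀ d ∈ p.darts, h d.snd - h d.fst = α d := by
  cases p with
  | nil => exact absurd hp not_isCycle_nil
  | @cons _ v _ hadj p =>
    rw [cons_isCycle_iff] at hp
    obtain ⟨h, hv, hd⟩ := hp.1.exists_potential α (c + α ⟨(u, v), hadj⟩)
    have hsum : (p.darts.map α).sum = h u - h v := by
      rw [← p.sum_darts_sub h]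
      congr 1
      exact List.map_congr_left fun d hdm ↦ (hd d hdm).symm
    rw [darts_cons, List.map_cons, List.sum_cons, hsum, hv] at hα
    have hu : h u = c := by linear_combination hα
    refine ⟨h, hu, fun d hdm ↦ ?_⟩
    rw [darts_cons, List.mem_cons] at hdm
    rcases hdm with rfl | hdm
    · simp [hv, hu]
    · exact hd d hdm

/-- A functional that kills coboundaries and does not see the edge `e` kills every cochain that is
a coboundary off `e`. -/
theorem map_eq_zero_of_eq_coboundary {e : G.edgeSet} [DecidableEq G.edgeSet]
    {Z : (G.edgeSet → ℂ) →ₗ[ℂ] ℂ} (hZ : ∀ h, Z (G.coboundary h) = 0) (hZe : Z (Pi.single e 1) = 0)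
    {a : G.edgeSet → ℂ} (h : V → ℂ) (ha : ∀ e' ≠ e, a e' = G.coboundary h e') : Z a = 0 := by
  have : a = G.coboundary h + (a e - G.coboundary h e) • Pi.single e 1 := by
    funext e'
    by_cases he : e' = e
    · subst he; simp
    · simp [he, ha e' he]
  rw [this, map_add, map_smul, hZ, hZe, smul_zero, add_zero]

theorem Connected.eq_of_coboundary_eq_zero (hG : G.Connected) {h : V → ℂ}
    (hh : G.coboundary h = 0) (u v : V) : h u = h v := by
  obtain ⟨p⟩ := hG u v
  have h1 := p.sum_darts_sub h
  simp_rw [← dartEval_coboundary, hh] at h1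
  simpa [sub_eq_zero, eq_comm] using h1

end SimpleGraph

/-! ### Logarithm cochains of an embedded graph -/

open SimpleGraph

namespace PlaneEmbedding

variable {V : Type*} {G : SimpleGraph V}

theorem exists_path_tail_head (Γ : PlaneEmbedding G) (e : G.edgeSet) :
    ∃ γ : Path (Γ.point (edgeTail e)) (Γ.point (edgeHead e)),
      Function.Injective γ ∧ range γ = Γ.arc e :=
  Γ.exists_path e _ _ (mk_edgeTail_edgeHead e).symm

theorem isCompact_arc (Γ : PlaneEmbedding G) (e : G.edgeSet) : IsCompact (Γ.arc e) := by
  obtain ⟨γ, -, h⟩ := Γ.exists_path_tail_head e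
  exact h ▸ isCompact_range γ.continuous

theorem isPreconnected_arc (Γ : PlaneEmbedding G) (e : G.edgeSet) : IsPreconnected (Γ.arc e) := by
  obtain ⟨γ, -, h⟩ := Γ.exists_path_tail_head e
  exact h ▸ isPreconnected_range γ.continuous

theorem point_mem_arc (Γ : PlaneEmbedding G) {e : G.edgeSet} {v : V} (hv : v ∈ (e : Sym2 V)) :
    Γ.point v ∈ Γ.arc e := by
  obtain ⟨w, hw⟩ := Sym2.mem_iff_exists.1 hv
  obtain ⟨γ, -, h⟩ := Γ.exists_path e v w hw
  exact h ▸ ⟨0, γ.source⟩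

theorem logEquivOn_arc (Γ : PlaneEmbedding G) {e : G.edgeSet} {p : Plane} (hp : p ∉ Γ.arc e) :
    LogEquivOn (Γ.arc e) (planeSub p) 1 := by
  obtain ⟨γ, hγ, h⟩ := Γ.exists_path_tail_head e
  rw [← h] at hp ⊢
  exact logEquivOn_range_path γ hγ (continuous_planeSub p) fun z hz ↦
    planeSub_ne_zero (ne_of_mem_of_not_mem hz hp)

/-- Every edge has a point that lies on no other edge. -/
theorem exists_mem_arc_forall_eq (Γ : PlaneEmbedding G) (e : G.edgeSet) :
    ∃ z ∈ Γ.arc e, ∀ e', z ∈ Γ.arc e' → e' = e := by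
  obtain ⟨γ, hγ, h⟩ := Γ.exists_path_tail_head e
  let t : unitInterval := ⟨1 / 2, by norm_num, by norm_num⟩
  have h0 : t ≠ 0 := fun h ↦ by simpa [t] using congrArg Subtype.val h
  have h1 : t ≠ 1 := fun h ↦ by simpa [t] using congrArg Subtype.val h
  refine ⟨γ t, h ▸ ⟨t, rfl⟩, fun e' he' ↦ by_contra fun hne ↦ ?_⟩
  obtain ⟨v, ⟨-, hv⟩, hvz⟩ := Γ.arc_inter_subset e' e hne ⟨he', h ▸ ⟨t, rfl⟩⟩
  rw [← mk_edgeTail_edgeHead e, Sym2.mem_iff] at hv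
  rcases hv with rfl | rfl
  · exact h0 (hγ (hvz.symm.trans γ.source.symm))
  · exact h1 (hγ (hvz.symm.trans γ.target.symm))

theorem arc_subset_support (Γ : PlaneEmbedding G) (e : G.edgeSet) : Γ.arc e ⊆ Γ.support :=
  fun _ hz ↦ Or.inr (mem_iUnion.2 ⟨e, hz⟩)

theorem isCompact_support [Finite V] (Γ : PlaneEmbedding G) : IsCompact Γ.support :=
  (finite_range Γ.point).isCompact.union (isCompact_iUnion Γ.isCompact_arc)

/-- The cochain of increments of a continuous logarithm of `z - p` along the oriented edges.  Its
imaginary part is the angle that the edge subtends at `p`.  It is meaningful if `p` lies on no edge;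
the increment along an edge through `p` has the junk value zero. -/
noncomputable def logCochain (Γ : PlaneEmbedding G) (p : Plane) (e : G.edgeSet) : ℂ :=
  logIncrement (Γ.arc e) (planeSub p) (Γ.point (edgeTail e)) (Γ.point (edgeHead e))

theorem logCochain_eq (Γ : PlaneEmbedding G) {p : Plane} {e : G.edgeSet} {g : Plane → ℂ}
    (hg : ContinuousOn g (Γ.arc e)) (h : ∀ z ∈ Γ.arc e, planeSub p z = Complex.exp (g z)) :
    Γ.logCochain p e = G.coboundary (g ∘ Γ.point) e :=
  logIncrement_eq (Γ.isPreconnected_arc e) hg h (Γ.point_mem_arc (edgeTail_mem e))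
    (Γ.point_mem_arc (edgeHead_mem e))

theorem logCochain_sub (Γ : PlaneEmbedding G) {p q : Plane} {e : G.edgeSet} (hq : q ∉ Γ.arc e)
    {g : Plane → ℂ} (hg : ContinuousOn g (Γ.arc e))
    (h : ∀ z ∈ Γ.arc e, planeSub p z = planeSub q z * Complex.exp (g z)) :
    Γ.logCochain p e - Γ.logCochain q e = G.coboundary (g ∘ Γ.point) e :=
  logIncrement_sub (Γ.isPreconnected_arc e) (Γ.logEquivOn_arc hq) hg h
    (Γ.point_mem_arc (edgeTail_mem e)) (Γ.point_mem_arc (edgeHead_mem e))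

theorem dartEval_logCochain (Γ : PlaneEmbedding G) (p : Plane) (d : G.Dart) :
    dartEval d (Γ.logCochain p) =
      logIncrement (Γ.arc d.toEdgeSet) (planeSub p) (Γ.point d.fst) (Γ.point d.snd) :=
  dartEval_eq (φ := fun x y ↦ logIncrement (Γ.arc d.toEdgeSet) (planeSub p) (Γ.point x) (Γ.point y))
    (fun _ _ ↦ logIncrement_symm _ _ _ _) rfl

/-- The circulation of `logCochain p` along a closed walk in a set on which `z - p` has a logarithm
is zero. -/
theorem circulation_logCochain_eq_zero (Γ : PlaneEmbedding G) {A : Set Plane} {p : Plane}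
    (h : LogEquivOn A (planeSub p) 1) {v : V} (w : G.Walk v v)
    (hw : ∀ e : G.edgeSet, (e : Sym2 V) ∈ w.edges → Γ.arc e ⊆ A) :
    w.circulation (Γ.logCochain p) = 0 := by
  obtain ⟨g, hg, hgp⟩ := h
  refine w.circulation_eq_zero (g ∘ Γ.point) fun d hd ↦ ?_
  have hA := hw d.toEdgeSet (List.mem_map_of_mem (f := Dart.edge) hd)
  exact Γ.logCochain_eq (hg.mono hA) fun z hz ↦ by simpa using hgp z (hA hz)

/-- If the circulation of `logCochain p` along a cycle is zero, then logarithms of `z - p` on the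
edges of the cycle can be chosen to agree at the vertices. -/
theorem logEquivOn_of_circulation_eq_zero [Finite V] (Γ : PlaneEmbedding G) {p : Plane} {v : V}
    {w : G.Walk v v} (hw : w.IsCycle)
    (hp : ∀ e : G.edgeSet, (e : Sym2 V) ∈ w.edges → p ∉ Γ.arc e)
    (h0 : w.circulation (Γ.logCochain p) = 0) :
    LogEquivOn (⋃ (e : G.edgeSet) (_ : (e : Sym2 V) ∈ w.edges), Γ.arc e) (planeSub p) 1 := by
  classical
  rw [Walk.circulation_apply] at h0
  obtain ⟨h, hv, hd⟩ := hw.exists_potential _ h0 (Complex.log (planeSub p (Γ.point v)))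
  have hpd : ∀ d ∈ w.darts, p ∉ Γ.arc d.toEdgeSet := fun d hdw ↦
    hp d.toEdgeSet (List.mem_map_of_mem (f := Dart.edge) hdw)
  have hfst : ∀ d : G.Dart, Γ.point d.fst ∈ Γ.arc d.toEdgeSet := fun d ↦
    Γ.point_mem_arc (Sym2.mem_mk_left _ _)
  have hsnd : ∀ d : G.Dart, Γ.point d.snd ∈ Γ.arc d.toEdgeSet := fun d ↦
    Γ.point_mem_arc (Sym2.mem_mk_right _ _)
  -- `exp h` agrees with `z - p` at all vertices of the cycle, by induction along the cycle
  have hstep : ∀ d ∈ w.darts, Complex.exp (h d.fst) = planeSub p (Γ.point d.fst) →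
      Complex.exp (h d.snd) = planeSub p (Γ.point d.snd) := by
    intro d hdw hdf
    have h1 := exp_logIncrement (Γ.logEquivOn_arc (hpd d hdw)) (hfst d) (hsnd d)
    rw [← dartEval_logCochain, ← hd d hdw, ← hdf, ← Complex.exp_add, add_sub_cancel] at h1
    exact h1
  have hprop : ∀ {a b : V} (q : G.Walk a b), (∀ d ∈ q.darts, d ∈ w.darts) →
      Complex.exp (h a) = planeSub p (Γ.point a) →
      ∀ d ∈ q.darts, Complex.exp (h d.fst) = planeSub p (Γ.point d.fst) := by
    intro a b q
    induction q with
    | nil => simp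
    | cons hadj q ih =>
      intro hsub ha d hdq
      rw [Walk.darts_cons] at hsub hdq
      rcases List.mem_cons.1 hdq with rfl | hdq
      · exact ha
      · exact ih (fun d hd ↦ hsub d (List.mem_cons_of_mem _ hd))
          (hstep _ (hsub _ List.mem_cons_self) ha) d hdq
  have hexp : ∀ d ∈ w.darts, Complex.exp (h d.fst) = planeSub p (Γ.point d.fst) := by
    cases w with
    | nil => simp
    | cons hadj q =>
      refine hprop _ (fun _ h ↦ h) ?_
      rw [hv, Complex.exp_log]
      exact planeSub_ne_zero
        (ne_of_mem_of_not_mem (hfst ⟨(_, _), hadj⟩) (hpd _ (by simp)))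
  have hlog : ∀ e : {e : G.edgeSet // (e : Sym2 V) ∈ w.edges}, ∃ g : Plane → ℂ,
      ContinuousOn g (Γ.arc e) ∧ (∀ z ∈ Γ.arc e, planeSub p z = Complex.exp (g z)) ∧
      ∀ x ∈ (e.1 : Sym2 V), g (Γ.point x) = h x := by
    rintro ⟨e, he⟩
    obtain ⟨d, hdw, hde⟩ := List.mem_map.1 he
    obtain rfl : d.toEdgeSet = e := Subtype.ext hde
    obtain ⟨k, hk, hkp⟩ := Γ.logEquivOn_arc (hpd d hdw)
    simp only [Pi.one_apply, one_mul] at hkp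
    refine ⟨fun z ↦ k z + (h d.fst - k (Γ.point d.fst)), hk.add continuousOn_const,
      fun z hz ↦ ?_, fun x hx ↦ ?_⟩
    · rw [Complex.exp_add, Complex.exp_sub, hexp d hdw, ← hkp _ (hfst d), ← hkp z hz, div_self,
        mul_one]
      exact planeSub_ne_zero (ne_of_mem_of_not_mem (hfst d) (hpd d hdw))
    · rcases Sym2.mem_iff.1 (show x ∈ s(d.fst, d.snd) from hx) with rfl | rfl
      · ring
      · have h1 := hd d hdw
        rw [dartEval_logCochain,
          logIncrement_eq (Γ.isPreconnected_arc _) hk hkp (hfst d) (hsnd d)] at h1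
        linear_combination -h1
  -- glue these logarithms, which agree where two edges of the cycle meet
  choose g hg hgp hgh using hlog
  let F : Plane → ℂ := fun z ↦
    if hz : ∃ e : {e : G.edgeSet // (e : Sym2 V) ∈ w.edges}, z ∈ Γ.arc e then g hz.choose z else 0
  have hF : ∀ (e : {e : G.edgeSet // (e : Sym2 V) ∈ w.edges}), ∀ z ∈ Γ.arc e, F z = g e z := by
    intro e z hz
    have hex : ∃ e : {e : G.edgeSet // (e : Sym2 V) ∈ w.edges}, z ∈ Γ.arc e := ⟨e, hz⟩
    simp only [F, dif_pos hex]
    by_cases heq : hex.choose = e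
    · rw [heq]
    · obtain ⟨x, ⟨hx, hx'⟩, rfl⟩ := Γ.arc_inter_subset hex.choose.1 e.1
        (fun h ↦ heq (Subtype.ext h)) ⟨hex.choose_spec, hz⟩
      rw [hgh _ x hx, hgh _ x hx']
  have hU : (⋃ (e : G.edgeSet) (_ : (e : Sym2 V) ∈ w.edges), Γ.arc e) =
      ⋃ e : {e : G.edgeSet // (e : Sym2 V) ∈ w.edges}, Γ.arc e :=
    (iUnion_subtype (fun e : G.edgeSet ↦ (e : Sym2 V) ∈ w.edges) fun e ↦ Γ.arc e).symm
  rw [hU]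
  refine ⟨F, (locallyFinite_of_finite _).continuousOn_iUnion
    (fun e ↦ (Γ.isCompact_arc e).isClosed) fun e ↦ (hg e).congr (hF e), fun z hz ↦ ?_⟩
  obtain ⟨e, hze⟩ := mem_iUnion.1 hz
  rw [hF e z hze, hgp e z hze, Pi.one_apply, one_mul]

/-! ### Tiles -/

/-- A complementary component of the graph whose closure contains `y` is the component of `y`. -/
theorem connectedComponentIn_eq_of_mem_closure [Finite V] (Γ : PlaneEmbedding G) {x y : Plane}
    (hy : y ∉ Γ.support) (h : y ∈ closure (connectedComponentIn Γ.supportᶜ x)) :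
    connectedComponentIn Γ.supportᶜ x = connectedComponentIn Γ.supportᶜ y := by
  have ho : IsOpen (connectedComponentIn Γ.supportᶜ y) :=
    Γ.isCompact_support.isClosed.isOpen_compl.connectedComponentIn
  obtain ⟨z, hzy, hzx⟩ := mem_closure_iff.1 h _ ho (mem_connectedComponentIn hy)
  rw [connectedComponentIn_eq hzx, connectedComponentIn_eq hzy]

/-- A chosen point of a complementary component whose closure is the given tile. -/
noncomputable def tilePoint (Γ : PlaneEmbedding G) (T : Γ.tiles) : Plane := T.2.choose

theorem tilePoint_notMem_support (Γ : PlaneEmbedding G) (T : Γ.tiles) :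
    Γ.tilePoint T ∉ Γ.support := T.2.choose_spec.1

theorem coe_eq_closure (Γ : PlaneEmbedding G) (T : Γ.tiles) :
    (T : Set Plane) = closure (connectedComponentIn Γ.supportᶜ (Γ.tilePoint T)) :=
  T.2.choose_spec.2

theorem tilePoint_mem (Γ : PlaneEmbedding G) (T : Γ.tiles) : Γ.tilePoint T ∈ (T : Set Plane) := by
  rw [Γ.coe_eq_closure T]
  exact subset_closure (mem_connectedComponentIn (Γ.tilePoint_notMem_support T))

theorem tilePoint_notMem_of_ne [Finite V] (Γ : PlaneEmbedding G) {T T' : Γ.tiles} (h : T ≠ T') :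
    Γ.tilePoint T' ∉ (T : Set Plane) := by
  intro hm
  rw [Γ.coe_eq_closure T] at hm
  refine h (Subtype.ext ?_)
  rw [Γ.coe_eq_closure T, Γ.coe_eq_closure T',
    Γ.connectedComponentIn_eq_of_mem_closure (Γ.tilePoint_notMem_support T') hm]

/-- There is at most one unbounded tile. -/
theorem eq_of_not_isBounded [Finite V] (Γ : PlaneEmbedding G) {T T' : Γ.tiles}
    (h : ¬ IsBounded (T : Set Plane)) (h' : ¬ IsBounded (T' : Set Plane)) : T = T' := by
  obtain ⟨R, hR⟩ := Γ.isCompact_support.isBounded.subset_closedBall 0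
  have hR' : Γ.support ⊆ Metric.closedBall 0 |R| :=
    hR.trans (Metric.closedBall_subset_closedBall (le_abs_self R))
  have key : ∀ T : Γ.tiles, ¬ IsBounded (T : Set Plane) →
      (Metric.closedBall 0 |R|)ᶜ ⊆ connectedComponentIn Γ.supportᶜ (Γ.tilePoint T) ∧
        ((Metric.closedBall (0 : Plane) |R|)ᶜ).Nonempty := by
    intro T hT
    rw [Γ.coe_eq_closure T, Metric.isBounded_closure_iff] at hT
    obtain ⟨y, hy, hyR⟩ : ∃ y ∈ connectedComponentIn Γ.supportᶜ (Γ.tilePoint T),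
        y ∉ Metric.closedBall (0 : Plane) |R| := by
      by_contra! hcon
      exact hT (Metric.isBounded_closedBall.subset hcon)
    rw [connectedComponentIn_eq hy]
    exact ⟨(isPreconnected_compl_closedBall (abs_nonneg R)).subset_connectedComponentIn hyR
      (compl_subset_compl.2 hR'), y, hyR⟩
  obtain ⟨hT, y, hy⟩ := key T h
  refine Subtype.ext ?_
  rw [Γ.coe_eq_closure T, Γ.coe_eq_closure T', connectedComponentIn_eq (hT hy),
    connectedComponentIn_eq ((key T' h').1 hy)]

/-- The logarithm cochain of a point in an unbounded tile is a coboundary. -/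
theorem exists_logCochain_eq_coboundary [Finite V] (Γ : PlaneEmbedding G) {T : Γ.tiles}
    (h : ¬ IsBounded (T : Set Plane)) :
    ∃ k, Γ.logCochain (Γ.tilePoint T) = G.coboundary k := by
  rw [Γ.coe_eq_closure T, Metric.isBounded_closure_iff] at h
  obtain ⟨g, hg, hgp⟩ := logEquivOn_planeSub_one Γ.isCompact_support
    isPreconnected_connectedComponentIn
    (disjoint_compl_left.mono_left (connectedComponentIn_subset _ _)) h
    (mem_connectedComponentIn (Γ.tilePoint_notMem_support T))
  exact ⟨g ∘ Γ.point, funext fun e ↦ Γ.logCochain_eq (hg.mono (Γ.arc_subset_support e))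
    fun z hz ↦ by simpa using hgp z (Γ.arc_subset_support e hz)⟩

/-- If two tiles share the edge `e`, then their points are not separated by the other edges, so
that their logarithm cochains differ by a coboundary off `e`. -/
theorem exists_logCochain_sub_eq_coboundary [Finite V] (Γ : PlaneEmbedding G) {T T' : Γ.tiles}
    {e : G.edgeSet} (h : Γ.arc e ⊆ frontier (T : Set Plane))
    (h' : Γ.arc e ⊆ frontier (T' : Set Plane)) :
    ∃ k, ∀ e' ≠ e, (Γ.logCochain (Γ.tilePoint T) - Γ.logCochain (Γ.tilePoint T')) e' =
      G.coboundary k e' := by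
  -- the two components and a point `z` of `e` between them form a connected set off the other edges
  obtain ⟨z, hz, hze⟩ := Γ.exists_mem_arc_forall_eq e
  let A : Set Plane := ⋃ e' : {e' : G.edgeSet // e' ≠ e}, Γ.arc e'
  have hA : IsClosed A := isClosed_iUnion_of_finite fun e' ↦ (Γ.isCompact_arc e').isClosed
  have hAs : A ⊆ Γ.support := iUnion_subset fun e' ↦ Γ.arc_subset_support e'
  have hzA : z ∉ A := fun hzA ↦ by
    obtain ⟨e', he'⟩ := mem_iUnion.1 hzA
    exact e'.2 (hze _ he')
  have hcl : ∀ T : Γ.tiles, Γ.arc e ⊆ frontier (T : Set Plane) →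
      z ∈ closure (connectedComponentIn Γ.supportᶜ (Γ.tilePoint T)) := fun T hT ↦ by
    rw [← Γ.coe_eq_closure T]
    have := frontier_subset_closure (hT hz)
    rwa [Γ.coe_eq_closure T, closure_closure, ← Γ.coe_eq_closure T] at this
  have hconn : ∀ T : Γ.tiles, Γ.arc e ⊆ frontier (T : Set Plane) →
      IsPreconnected (insert z (connectedComponentIn Γ.supportᶜ (Γ.tilePoint T))) := fun T hT ↦
    isPreconnected_connectedComponentIn.subset_closure (subset_insert _ _)
      (insert_subset (hcl T hT) subset_closure)
  have hdisj : ∀ T : Γ.tiles,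
      Disjoint (insert z (connectedComponentIn Γ.supportᶜ (Γ.tilePoint T))) A := fun T ↦ by
    refine disjoint_left.2 ?_
    rintro y (rfl | hy) hyA
    · exact hzA hyA
    · exact connectedComponentIn_subset _ _ hy (hAs hyA)
  obtain ⟨g, hg, hgp⟩ := logEquivOn_planeSub_of_isPreconnected hA
    ((hconn T h).union z (mem_insert _ _) (mem_insert _ _) (hconn T' h'))
    ((hdisj T).union_left (hdisj T'))
    (Or.inl (mem_insert_of_mem _ (mem_connectedComponentIn (Γ.tilePoint_notMem_support T))))
    (Or.inr (mem_insert_of_mem _ (mem_connectedComponentIn (Γ.tilePoint_notMem_support T'))))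
  refine ⟨g ∘ Γ.point, fun e' he' ↦ ?_⟩
  have hsub : Γ.arc e' ⊆ A := subset_iUnion (fun e' : {e' : G.edgeSet // e' ≠ e} ↦ Γ.arc e')
    ⟨e', he'⟩
  exact Γ.logCochain_sub (fun hm ↦ Γ.tilePoint_notMem_support T' (Γ.arc_subset_support e' hm))
    (hg.mono hsub) fun y hy ↦ hgp y (hsub hy)

/-- A closed disc does not separate the plane, so a point `q` outside of it can be moved to infinity
and `z - q` has a logarithm on the disc. -/
theorem _root_.IsClosedTopologicalDisc.logEquivOn {T : Set Plane} (hT : IsClosedTopologicalDisc T)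
    {q : Plane} (hq : q ∉ T) : LogEquivOn T (planeSub q) 1 := by
  obtain ⟨φ, rfl⟩ := hT
  have hc : IsCompact (φ '' Metric.closedBall 0 1) :=
    (isCompact_closedBall 0 1).image φ.continuous
  have hpre : IsPreconnected (φ '' Metric.closedBall 0 1)ᶜ := by
    rw [← image_compl_eq φ.bijective]
    exact (isPreconnected_compl_closedBall zero_le_one).image _ φ.continuous.continuousOn
  refine logEquivOn_planeSub_one hc hpre disjoint_compl_left (fun hb ↦ ?_) hq
  apply NormedSpace.unbounded_univ ℝ Plane
  rw [← compl_union_self (φ '' Metric.closedBall 0 1)]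
  exact hb.union hc.isBounded


/-- The set of bounded tiles. -/
def boundedTiles (Γ : PlaneEmbedding G) : Set (Set Plane) := {T | T ∈ Γ.tiles ∧ IsBounded T}

/-- A bounded tile, as a tile. -/
def boundedTiles.toTile {Γ : PlaneEmbedding G} (T : Γ.boundedTiles) : Γ.tiles := ⟨T, T.2.1⟩

theorem arc_subset_iUnion_iff (Γ : PlaneEmbedding G) {v : V} (w : G.Walk v v) (e : G.edgeSet) :
    Γ.arc e ⊆ (⋃ (e : G.edgeSet) (_ : (e : Sym2 V) ∈ w.edges), Γ.arc e) ↔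
      (e : Sym2 V) ∈ w.edges := by
  refine ⟨fun h ↦ ?_, fun h ↦ subset_iUnion₂_of_subset e h Subset.rfl⟩
  obtain ⟨z, hz, hze⟩ := Γ.exists_mem_arc_forall_eq e
  obtain ⟨e', he', hz'⟩ := mem_iUnion₂.1 (h hz)
  exact hze e' hz' ▸ he'

/-- The boundary cycle of a bounded tile winds around the chosen point of the tile and not around
points outside of the tile. -/
theorem exists_cycle (Γ : PlaneEmbedding G) (hΓ : IsFiniteTessellating Γ) (T : Γ.tiles)
    (hT : IsBounded (T : Set Plane)) :
    ∃ (v : V) (w : G.Walk v v), w.IsCycle ∧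
      (∀ e : G.edgeSet, Γ.arc e ⊆ frontier (T : Set Plane) ↔ (e : Sym2 V) ∈ w.edges) ∧
      (∀ q ∉ (T : Set Plane), w.circulation (Γ.logCochain q) = 0) ∧
      w.circulation (Γ.logCochain (Γ.tilePoint T)) ≠ 0 := by
  have := hΓ.finite_vertices
  obtain ⟨hdisc, v, w, hw, -, hfr⟩ := hΓ.bounded_tile T T.2 hT
  have hcl : IsClosed (T : Set Plane) := by
    rw [Γ.coe_eq_closure T]
    exact isClosed_closure
  have hmem : ∀ e : G.edgeSet, Γ.arc e ⊆ frontier (T : Set Plane) ↔ (e : Sym2 V) ∈ w.edges := by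
    rw [hfr]
    exact Γ.arc_subset_iUnion_iff w
  refine ⟨v, w, hw, hmem, fun q hq ↦ ?_, fun h0 ↦ ?_⟩
  · exact Γ.circulation_logCochain_eq_zero (hdisc.logEquivOn hq) w fun e he ↦
      ((hmem e).2 he).trans hcl.frontier_subset
  · have := Γ.logEquivOn_of_circulation_eq_zero hw
      (fun e _ he ↦ Γ.tilePoint_notMem_support T (Γ.arc_subset_support e he)) h0
    rw [← hfr] at this
    exact not_logEquivOn_planeSub_frontier (Metric.isCompact_of_isClosed_isBounded hcl hT)
      (Γ.tilePoint_mem T) this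

theorem exists_arc_subset_frontier (Γ : PlaneEmbedding G) (hΓ : IsFiniteTessellating Γ)
    {T : Set Plane} (hT : T ∈ Γ.boundedTiles) : ∃ e, Γ.arc e ⊆ frontier T := by
  obtain ⟨v, w, hw, hmem, -⟩ := Γ.exists_cycle hΓ ⟨T, hT.1⟩ hT.2
  cases w with
  | nil => exact absurd hw Walk.not_isCycle_nil
  | @cons _ u _ hadj w => exact ⟨⟨s(v, u), hadj⟩, (hmem _).2 (by simp)⟩

theorem finite_boundedTiles (Γ : PlaneEmbedding G) (hΓ : IsFiniteTessellating Γ) :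
    Γ.boundedTiles.Finite := by
  have := hΓ.finite_vertices
  refine (finite_iUnion fun e ↦ finite_of_ncard_pos (by rw [hΓ.edge_tiles e]; norm_num)).subset
    (s := ⋃ e, Γ.edgeTiles e) fun T hT ↦ ?_
  obtain ⟨e, he⟩ := Γ.exists_arc_subset_frontier hΓ hT
  exact mem_iUnion.2 ⟨e, hT.1, he⟩

open Classical in
/-- If the bounded tile `T` and the tile `T'` share the edge `e`, then a functional that kills
coboundaries and the logarithm cochains of both tiles does not see `e`: subtracting a multiple of
the circulation around `T` removes `e`, and off `e` the difference of the two logarithm cochains is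
a coboundary. -/
theorem map_single_eq_zero (Γ : PlaneEmbedding G) (hΓ : IsFiniteTessellating Γ)
    {Z : (G.edgeSet → ℂ) →ₗ[ℂ] ℂ} (hZ : ∀ h, Z (G.coboundary h) = 0)
    {T T' : Γ.tiles} (hne : T ≠ T') (hT : IsBounded (T : Set Plane)) {e : G.edgeSet}
    (h : Γ.arc e ⊆ frontier (T : Set Plane)) (h' : Γ.arc e ⊆ frontier (T' : Set Plane))
    (hZT : Z (Γ.logCochain (Γ.tilePoint T)) = 0) (hZT' : Z (Γ.logCochain (Γ.tilePoint T')) = 0) :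
    Z (Pi.single e 1) = 0 := by
  have := hΓ.finite_vertices
  obtain ⟨v, w, hw, hmem, hout, hin⟩ := Γ.exists_cycle hΓ T hT
  have he := Walk.circulation_single_ne_zero hw.edges_nodup ((hmem e).1 h)
  obtain ⟨k, hk⟩ := Γ.exists_logCochain_sub_eq_coboundary h h'
  have key := map_eq_zero_of_eq_coboundary
    (Z := Z - (Z (Pi.single e 1) / w.circulation (Pi.single e 1)) • w.circulation)
    (fun f ↦ by simp [hZ, Walk.circulation_coboundary]) (by simp [he]) k hk
  have hout' := hout _ (Γ.tilePoint_notMem_of_ne hne)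
  simpa [hZT, hZT', hout', hin, he] using key

/-- The coboundaries and the logarithm cochains of the bounded tiles span the cochains. -/
theorem eq_zero_of_map_logCochain_eq_zero (Γ : PlaneEmbedding G) (hΓ : IsFiniteTessellating Γ)
    {Z : (G.edgeSet → ℂ) →ₗ[ℂ] ℂ} (hZ : ∀ h, Z (G.coboundary h) = 0)
    (hZT : ∀ T : Γ.tiles, IsBounded (T : Set Plane) → Z (Γ.logCochain (Γ.tilePoint T)) = 0) :
    Z = 0 := by
  classical
  have := hΓ.finite_vertices
  have hall : ∀ T : Γ.tiles, Z (Γ.logCochain (Γ.tilePoint T)) = 0 := fun T ↦ by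
    by_cases hT : IsBounded (T : Set Plane)
    · exact hZT T hT
    · obtain ⟨k, hk⟩ := Γ.exists_logCochain_eq_coboundary hT
      rw [hk, hZ]
  refine LinearMap.pi_ext' fun e ↦ LinearMap.ext_ring ?_
  obtain ⟨T, T', hne, hTT'⟩ := ncard_eq_two.1 (hΓ.edge_tiles e)
  have hT : T ∈ Γ.edgeTiles e := by simp [hTT']
  have hT' : T' ∈ Γ.edgeTiles e := by simp [hTT']
  have hne' : (⟨T, hT.1⟩ : Γ.tiles) ≠ ⟨T', hT'.1⟩ := fun h ↦ hne (congrArg Subtype.val h)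
  by_cases hb : IsBounded T
  · exact Γ.map_single_eq_zero hΓ hZ hne' hb hT.2 hT'.2 (hall _) (hall _)
  · by_cases hb' : IsBounded T'
    · exact Γ.map_single_eq_zero hΓ hZ hne'.symm hb' hT'.2 hT.2 (hall _) (hall _)
    · exact absurd (Γ.eq_of_not_isBounded hb hb') hne'

/-! ### Euler's formula -/

/-- **Euler's formula**, with the bounded tiles as faces. -/
theorem card_add_ncard_boundedTiles (Γ : PlaneEmbedding G) (hΓ : IsFiniteTessellating Γ) :
    Nat.card V + Γ.boundedTiles.ncard = Nat.card G.edgeSet + 1 := by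
  classical
  have := hΓ.finite_vertices
  have : Finite Γ.boundedTiles := Γ.finite_boundedTiles hΓ
  have := Fintype.ofFinite V
  have := Fintype.ofFinite G.edgeSet
  have := Fintype.ofFinite Γ.boundedTiles
  let a : Γ.boundedTiles → G.edgeSet → ℂ := fun T ↦
    Γ.logCochain (Γ.tilePoint (boundedTiles.toTile T))
  let Φ : ((V → ℂ) × (Γ.boundedTiles → ℂ)) →ₗ[ℂ] (G.edgeSet → ℂ) :=
    G.coboundary.coprod (Fintype.linearCombination ℂ a)
  have hrange : LinearMap.range Φ = ⊤ := by
    by_contra hne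
    obtain ⟨Z, hZ0, hZ⟩ := Submodule.exists_le_ker_of_lt_top _ (lt_top_iff_ne_top.2 hne)
    have hker : ∀ x, Z (Φ x) = 0 := fun x ↦ hZ ⟨x, rfl⟩
    refine hZ0 (Γ.eq_zero_of_map_logCochain_eq_zero hΓ (fun h ↦ ?_) fun T hT ↦ ?_)
    · simpa [Φ] using hker (h, 0)
    · simpa [Φ, a, boundedTiles.toTile] using hker (0, Pi.single ⟨T, T.2, hT⟩ 1)
  have hker : LinearMap.ker Φ =
      Submodule.span ℂ {((fun _ ↦ 1, 0) : (V → ℂ) × (Γ.boundedTiles → ℂ))} := by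
    refine le_antisymm (fun x hx ↦ ?_) ?_
    · obtain ⟨h, c⟩ := x
      have hx' : G.coboundary h + ∑ T, c T • a T = 0 := hx
      have hc : c = 0 := by
        funext T
        obtain ⟨v, w, -, -, hout, hin⟩ := Γ.exists_cycle hΓ (boundedTiles.toTile T) T.2.2
        have h1 := congrArg w.circulation hx'
        rw [map_add, Walk.circulation_coboundary, zero_add, map_sum,
          Finset.sum_eq_single T (fun T' _ hne ↦ ?_) (by simp), map_smul, map_zero,
          smul_eq_mul] at h1
        · exact (mul_eq_zero.1 h1).resolve_right hin
        · rw [map_smul, hout _ (Γ.tilePoint_notMem_of_ne fun heq ↦ hne <|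
            Subtype.ext (congrArg Subtype.val heq).symm), smul_zero]
      subst hc
      have hh : G.coboundary h = 0 := by simpa using hx'
      obtain ⟨v⟩ := hΓ.connected.nonempty
      refine Submodule.mem_span_singleton.2 ⟨h v, Prod.ext (funext fun u ↦ ?_) (by simp)⟩
      simpa using hΓ.connected.eq_of_coboundary_eq_zero hh v u
    · rw [Submodule.span_singleton_le_iff_mem, LinearMap.mem_ker]
      ext e
      simp [Φ]
  have hdim := LinearMap.finrank_range_add_finrank_ker Φ
  obtain ⟨v⟩ := hΓ.connected.nonempty
  rw [hrange, hker, finrank_top, finrank_span_singleton (fun h ↦ by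
    simpa using congrFun (congrArg Prod.fst h) v), Module.finrank_prod,
    Module.finrank_fintype_fun_eq_card, Module.finrank_fintype_fun_eq_card,
    Module.finrank_fintype_fun_eq_card] at hdim
  rw [Nat.card_eq_fintype_card, Nat.card_eq_fintype_card, ← Nat.card_coe_set_eq,
    Nat.card_eq_fintype_card, hdim]

end PlaneEmbedding

/-! ### The sum of the characteristic values -/

open PlaneEmbedding in
/-- For a finite tessellating metric graph, `∑_{e} -c(e)|e| = 1`. -/
theorem corollary3p6 {V : Type*} (G : SimpleGraph V) (Γ : PlaneEmbedding G)
    (hΓ : IsFiniteTessellating Γ) (ℓ : G.edgeSet → ℝ) (hℓ : ∀ e, 0 < ℓ e) :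
    ∑ᶠ e : G.edgeSet, -Γ.charValue ℓ e * ℓ e = 1 := by
  classical
  have := hΓ.finite_vertices
  have := Fintype.ofFinite V
  have := Fintype.ofFinite G.edgeSet
  have hfin := Γ.finite_boundedTiles hΓ
  have hw : ∀ v, weight ℓ v = ∑ e : G.edgeSet, if v ∈ (e : Sym2 V) then ℓ e else 0 := fun v ↦ by
    simp only [weight, finsum_eq_if, finsum_eq_sum_of_fintype]
  have hvertex : ∀ v, ∑ e : G.edgeSet, (if v ∈ (e : Sym2 V) then 1 / weight ℓ v else 0) * ℓ e
      = 1 := fun v ↦ by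
    have hpos : 0 < weight ℓ v := by
      obtain ⟨e, he, hve⟩ : (G.incidenceSet v).Nonempty :=
        nonempty_of_ncard_ne_zero (by have := hΓ.three_le_degree v; omega)
      rw [hw]
      refine Finset.sum_pos' (fun e _ ↦ by split_ifs <;> simp [(hℓ e).le])
        ⟨⟨e, he⟩, Finset.mem_univ _, by simp [hve, hℓ]⟩
    calc _ = ∑ e : G.edgeSet, (1 / weight ℓ v) * if v ∈ (e : Sym2 V) then ℓ e else 0 :=
          Finset.sum_congr rfl fun e _ ↦ by split_ifs <;> simp
      _ = 1 := by rw [← Finset.mul_sum, ← hw, one_div_mul_cancel hpos.ne']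
  have htile : ∀ T ∈ hfin.toFinset, ∑ e : G.edgeSet,
      (if Γ.arc e ⊆ frontier T then ((Γ.perimeter ℓ T)⁻¹).toReal else 0) * ℓ e = 1 := by
    intro T hT
    have hT' : T ∈ Γ.boundedTiles := hfin.mem_toFinset.1 hT
    have hp : Γ.perimeter ℓ T =
        ENNReal.ofReal (∑ e : G.edgeSet, if Γ.arc e ⊆ frontier T then ℓ e else 0) := by
      simp only [perimeter, if_pos hT'.2, tileEdges, mem_ofPred_eq, finsum_eq_if,
        finsum_eq_sum_of_fintype]
    have hpos : 0 < ∑ e : G.edgeSet, if Γ.arc e ⊆ frontier T then ℓ e else 0 := by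
      obtain ⟨e, he⟩ := Γ.exists_arc_subset_frontier hΓ hT'
      exact Finset.sum_pos' (fun e _ ↦ by split_ifs <;> simp [(hℓ e).le])
        ⟨e, Finset.mem_univ _, by simp [he, hℓ]⟩
    rw [hp, ENNReal.toReal_inv, ENNReal.toReal_ofReal hpos.le]
    calc _ = ∑ e : G.edgeSet, (∑ e : G.edgeSet, if Γ.arc e ⊆ frontier T then ℓ e else 0)⁻¹ *
            if Γ.arc e ⊆ frontier T then ℓ e else 0 :=
          Finset.sum_congr rfl fun e _ ↦ by split_ifs <;> simp
      _ = 1 := by rw [← Finset.mul_sum, inv_mul_cancel₀ hpos.ne']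
  have hedge : ∀ e, -Γ.charValue ℓ e * ℓ e =
      ∑ v, (if v ∈ (e : Sym2 V) then 1 / weight ℓ v else 0) * ℓ e
      + ∑ T ∈ hfin.toFinset,
        (if Γ.arc e ⊆ frontier T then ((Γ.perimeter ℓ T)⁻¹).toReal else 0) * ℓ e - 1 := fun e ↦ by
    have hv : ∑ᶠ (v : V) (_ : v ∈ (e : Sym2 V)), 1 / weight ℓ v =
        ∑ v, if v ∈ (e : Sym2 V) then 1 / weight ℓ v else 0 := by
      simp only [finsum_eq_if, finsum_eq_sum_of_fintype]
    -- unbounded tiles have infinite perimeter and do not contribute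
    have ht : ∑ᶠ T ∈ Γ.edgeTiles e, ((Γ.perimeter ℓ T)⁻¹).toReal = ∑ T ∈ hfin.toFinset,
        if Γ.arc e ⊆ frontier T then ((Γ.perimeter ℓ T)⁻¹).toReal else 0 := by
      rw [← Finset.sum_filter]
      refine finsum_mem_eq_sum_of_inter_support_eq _ ?_
      ext T
      have hb : ((Γ.perimeter ℓ T)⁻¹).toReal ≠ 0 → IsBounded T := fun h ↦ by
        by_contra hb
        exact h (by simp [perimeter, hb])
      simp only [edgeTiles, boundedTiles, mem_inter_iff, mem_ofPred_eq, Function.mem_support,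
        Finset.coe_filter, Finite.mem_toFinset]
      tauto
    have hne := (hℓ e).ne'
    rw [charValue, hv, ht, ← Finset.sum_mul, ← Finset.sum_mul]
    field_simp
    ring
  have heuler : (Nat.card V : ℝ) + Γ.boundedTiles.ncard = Nat.card G.edgeSet + 1 := by
    exact_mod_cast Γ.card_add_ncard_boundedTiles hΓ
  rw [finsum_eq_sum_of_fintype, Finset.sum_congr rfl fun e _ ↦ hedge e, Finset.sum_sub_distrib,
    Finset.sum_add_distrib, Finset.sum_comm, Finset.sum_congr rfl fun v _ ↦ hvertex v,
    Finset.sum_comm, Finset.sum_congr rfl htile]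
  rw [ncard_eq_toFinset_card _ hfin, Nat.card_eq_fintype_card, Nat.card_eq_fintype_card] at heuler
  simp only [Finset.sum_const, Finset.card_univ, nsmul_eq_mul, mul_one]
  linarith
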